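/- Let $n\ge 2$, let $N$ be a nonempty compact smooth manifold without boundary of dimension $n-1$, and let $F_0:N\to\mathbb{H}^n$ be a smooth embedding into hyperbolic $n$-space (of constant curvature $-1$), with image $\Sigma_0=F_0(N)$. A smooth mean curvature flow on $[0,T)$, $0\le T\le\infty$, starting at $F_0$ is a smooth map $F:N\times[0,T)\to\mathbb{H}^n$ with $F(\cdot,0)=F_0$ such that every $F(\cdot,t)$ is an immersion and $$\partial_t F(x,t)=-H\nu ,$$ where $\nu$ is a unit normal of $F(\cdot,t)$ at $x$ and $H$ is the mean curvature with respect to $\nu$, i.e. the arithmetic mean $\frac{1}{n-1}(k_1+\dots+k_{n-1})$ of the principal curvatures (with the sign for which geodesic spheres have $H>0$ with respect to the outer normal; the vector $-H\nu$ does not depend on the choice between $\nu$ and $-\nu$). Let $T_{\max}\in[0,\infty]$ be the maximal time of smooth existence, i.e. the supremum of all $T$ for which such a flow on $[0,T)$ exists. Then $$T_{\max}\le \ln\bigl(\cosh(\operatorname{diam}(\Sigma_0))\bigr),\qquad \operatorname{diam}(\Sigma_0)=\max_{p,q\in\Sigma_0}d(p,q),$$ where $d$ is the hyperbolic distance of $\mathbb{H}^n$.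 -/

import Mathlib

open scoped Manifold ContDiff ENNReal

noncomputable section

namespace HyperbolicMCF

/-- The Lorentzian inner product `⟨x, y⟩ = -x₀ y₀ + x₁ y₁ + ⋯ + xₙ yₙ` on `ℝⁿ⁺¹`. -/
def lorentz {n : ℕ} (x y : EuclideanSpace ℝ (Fin (n + 1))) : ℝ :=
  -(x 0 * y 0) + ∑ i : Fin n, x i.succ * y i.succ

/-- Hyperbolic space `ℍⁿ` (hyperboloid model): the upper sheet of `⟨x, x⟩ = -1` in `ℝⁿ⁺¹`.
Its Riemannian metric is the restriction of `lorentz` to its tangent spaces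
`T_p ℍⁿ = {v | ⟨p, v⟩ = 0}`; its topology and smooth structure are those of a submanifold
of `ℝⁿ⁺¹`, so a map into it is smooth (an immersion, an embedding) if and only if it is so
as a map into `ℝⁿ⁺¹`. -/
def hyperbolicSpace (n : ℕ) : Set (EuclideanSpace ℝ (Fin (n + 1))) :=
  {x | lorentz x x = -1 ∧ 0 < x 0}

/-- The hyperbolic distance: `cosh d(p, q) = -⟨p, q⟩`. -/
def hypDist {n : ℕ} (p q : hyperbolicSpace n) : ℝ :=
  Real.arcosh (-lorentz (p : EuclideanSpace ℝ (Fin (n + 1))) q)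

/-- The extrinsic diameter `sup {d(p, q) | p, q ∈ S}` (a maximum when `S` is compact and
nonempty). -/
def hypDiam {n : ℕ} (S : Set (hyperbolicSpace n)) : ℝ :=
  sSup {r | ∃ p ∈ S, ∃ q ∈ S, r = hypDist p q}

variable {m : ℕ} {N : Type*} [TopologicalSpace N] [ChartedSpace (EuclideanSpace ℝ (Fin m)) N]

/-- A map from an `m`-manifold to `ℍᵐ⁺¹`, seen as a map into the ambient `ℝᵐ⁺²`. -/
def ambient (F : N → hyperbolicSpace (m + 1)) (x : N) : EuclideanSpace ℝ (Fin (m + 2)) :=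
  (F x : EuclideanSpace ℝ (Fin (m + 2)))

/-- `F : N → ℍᵐ⁺¹` is a smooth immersion. -/
structure IsSmoothImmersion (F : N → hyperbolicSpace (m + 1)) : Prop where
  smooth : ContMDiff (𝓡 m) 𝓘(ℝ, EuclideanSpace ℝ (Fin (m + 2))) ∞ (ambient F)
  injective_mfderiv : ∀ x, Function.Injective
    (mfderiv (𝓡 m) 𝓘(ℝ, EuclideanSpace ℝ (Fin (m + 2))) (ambient F) x)

/-- `F : N → ℍᵐ⁺¹` is a smooth embedding: an immersion that is a homeomorphism onto its image. -/
structure IsSmoothEmbedding (F : N → hyperbolicSpace (m + 1)) : Prop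
    extends IsSmoothImmersion F where
  isEmbedding : Topology.IsEmbedding F

/-- `ν` is a unit normal vector at `x` to the hypersurface parametrized by `F`: it is tangent
to `ℍᵐ⁺¹` at `F x`, orthogonal to the image of the differential of `F`, and of length one. -/
structure IsUnitNormal (F : N → hyperbolicSpace (m + 1)) (x : N)
    (ν : EuclideanSpace ℝ (Fin (m + 2))) : Prop where
  tangent : lorentz (ambient F x) ν = 0
  normal : ∀ v : TangentSpace (𝓡 m) x,
    lorentz (mfderiv (𝓡 m) 𝓘(ℝ, EuclideanSpace ℝ (Fin (m + 2))) (ambient F) x v) ν = 0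
  unit : lorentz ν ν = 1

/-- `F` read in the chart of `N` around `x`. -/
def localMap (F : N → hyperbolicSpace (m + 1)) (x : N) :
    EuclideanSpace ℝ (Fin m) → EuclideanSpace ℝ (Fin (m + 2)) :=
  ambient F ∘ (extChartAt (𝓡 m) x).symm

/-- The partial derivative `∂ᵢ f` at `y`. -/
def partialDeriv (i : Fin m) (f : EuclideanSpace ℝ (Fin m) → EuclideanSpace ℝ (Fin (m + 2)))
    (y : EuclideanSpace ℝ (Fin m)) : EuclideanSpace ℝ (Fin (m + 2)) :=
  fderiv ℝ f y (EuclideanSpace.single i 1)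

/-- The first fundamental form (induced metric) `gᵢⱼ = ⟨∂ᵢF, ∂ⱼF⟩` at `x`, in the chart
around `x`. -/
def firstFundamentalForm (F : N → hyperbolicSpace (m + 1)) (x : N) :
    Matrix (Fin m) (Fin m) ℝ :=
  Matrix.of fun i j =>
    lorentz (partialDeriv i (localMap F x) (extChartAt (𝓡 m) x x))
      (partialDeriv j (localMap F x) (extChartAt (𝓡 m) x x))

/-- The second fundamental form `hᵢⱼ = ⟨∇ᵢν, ∂ⱼF⟩ = -⟨∇ᵢ∂ⱼF, ν⟩ = -⟨∂ᵢ∂ⱼF, ν⟩` at `x` with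
respect to the unit normal `ν`, in the chart around `x`. The Levi-Civita connection `∇` of the
hyperboloid is the tangential part of the flat derivative of `ℝᵐ⁺²`, and `ν` is tangent to the
hyperboloid, which gives the last equality. The sign is such that geodesic spheres have positive
definite `h` with respect to the outer normal. -/
def secondFundamentalForm (F : N → hyperbolicSpace (m + 1)) (x : N)
    (ν : EuclideanSpace ℝ (Fin (m + 2))) : Matrix (Fin m) (Fin m) ℝ :=
  Matrix.of fun i j =>
    -lorentz (partialDeriv i (partialDeriv j (localMap F x)) (extChartAt (𝓡 m) x x)) ν

/-- The mean curvature with respect to `ν`: the arithmetic mean of the `m` principal curvatures,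
`H = (1 / m) gⁱʲ hᵢⱼ`. -/
def meanCurvature (F : N → hyperbolicSpace (m + 1)) (x : N)
    (ν : EuclideanSpace ℝ (Fin (m + 2))) : ℝ :=
  ((firstFundamentalForm F x)⁻¹ * secondFundamentalForm F x ν).trace / m

/-- The time interval `[0, T)`, where `T` may be infinite. -/
def timeInterval (T : ℝ≥0∞) : Set ℝ :=
  {t | 0 ≤ t ∧ ENNReal.ofReal t < T}

/-- `F : N × [0, T) → ℍᵐ⁺¹`, with `F t = F(·, t)`, is a smooth mean curvature flow starting
at `F₀`: it is smooth (up to `t = 0`), every `F t` is an immersion, and `∂ₜF = -H ν`.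
The product `H ν` does not change when `ν` is replaced by `-ν` and an immersed hypersurface has
exactly two unit normals at each point, so it does not matter which of the two is used (for
an embedded closed hypersurface one may take the outer one). -/
structure IsMeanCurvatureFlow (F₀ : N → hyperbolicSpace (m + 1)) (T : ℝ≥0∞)
    (F : ℝ → N → hyperbolicSpace (m + 1)) : Prop where
  smooth : ContMDiffOn ((𝓡 m).prod 𝓘(ℝ, ℝ)) 𝓘(ℝ, EuclideanSpace ℝ (Fin (m + 2))) ∞
    (fun z : N × ℝ => ambient (F z.2) z.1) (Set.univ ×ˢ timeInterval T)
  immersion : ∀ t ∈ timeInterval T, IsSmoothImmersion (F t)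
  evolution : ∀ t ∈ timeInterval T, ∀ x, ∃ ν, IsUnitNormal (F t) x ν ∧
    HasDerivWithinAt (fun s => ambient (F s) x) (-(meanCurvature (F t) x ν • ν))
      (timeInterval T) t
  initial : F 0 = F₀

/-- The maximal time of smooth existence of the mean curvature flow starting at `F₀`: the
supremum in `[0, ∞]` of all `T` such that there is a smooth flow on `[0, T)`. -/
def maximalTime (F₀ : N → hyperbolicSpace (m + 1)) : ℝ≥0∞ :=
  sSup {T | ∃ F, IsMeanCurvatureFlow F₀ T F}

end HyperbolicMCF

end

/-! Fix a point `p` of the initial hypersurface and follow `u = -⟨p, F⟩ = cosh d(p, F)` along the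
flow. At a spatial maximum of `u` the tangential part of `p` vanishes, so `p = u F + ⟨p, ν⟩ ν`
(`eq_position_add_normal`). The Hessian of `u` there is `u g + ⟨p, ν⟩ h`, which is nonpositive. Its
trace with respect to `g`, divided by `m`, gives `u + ⟨p, ν⟩ H ≤ 0`
(`neg_lorentz_add_trace_le_zero`).

The flow equation reads `∂ₜu = H ⟨p, ν⟩`, so `∂ₜu ≤ -u` at such points. By the maximum principle `eᵗ
u` never exceeds the initial maximum of `u` (`IsMeanCurvatureFlow.exp_mul_neg_lorentz_le`), which is
at most `cosh (diam Σ₀)`. Since `u ≥ 1` on hyperbolic space, `eᵗ ≤ cosh (diam Σ₀)` as long as the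
flow exists. -/

namespace HyperbolicMCF

/-! ### Lorentzian linear algebra on the hyperboloid -/

/-- The Lorentzian inner product as a continuous bilinear form. -/
noncomputable def lorentzCLM (n : ℕ) : EuclideanSpace ℝ (Fin (n + 1)) →L[ℝ]
    EuclideanSpace ℝ (Fin (n + 1)) →L[ℝ] ℝ :=
  LinearMap.toContinuousBilinearMap
    (LinearMap.mk₂ ℝ (fun x y => lorentz x y)
      (fun x x' y => by
        simp only [lorentz, PiLp.add_apply, add_mul, Finset.sum_add_distrib]; ring)
      (fun c x y => by
        simp only [lorentz, PiLp.smul_apply, smul_eq_mul, mul_assoc, ← Finset.mul_sum]; ring)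
      (fun x y y' => by
        simp only [lorentz, PiLp.add_apply, mul_add, Finset.sum_add_distrib]; ring)
      (fun c x y => by
        simp only [lorentz, PiLp.smul_apply, smul_eq_mul, mul_left_comm _ c, ← Finset.mul_sum]
        ring))

@[simp]
theorem lorentzCLM_apply {n : ℕ} (x y : EuclideanSpace ℝ (Fin (n + 1))) :
    lorentzCLM n x y = lorentz x y := rfl

theorem lorentz_comm {n : ℕ} (x y : EuclideanSpace ℝ (Fin (n + 1))) :
    lorentz x y = lorentz y x := by
  simp only [lorentz, mul_comm]

theorem eq_zero_of_forall_lorentz_eq_zero {n : ℕ} {x : EuclideanSpace ℝ (Fin (n + 1))}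
    (h : ∀ y, lorentz x y = 0) : x = 0 := by
  ext i
  refine Fin.cases ?_ (fun j => ?_) i
  · simpa [lorentz] using h (EuclideanSpace.single 0 1)
  · simpa [lorentz, Fin.succ_ne_zero, Fin.succ_inj] using h (EuclideanSpace.single j.succ 1)

/-- Nonzero tangent vectors of hyperbolic space are spacelike. -/
theorem lorentz_self_pos {n : ℕ} {p v : EuclideanSpace ℝ (Fin (n + 1))}
    (hp : p ∈ hyperbolicSpace n) (hpv : lorentz p v = 0) (hv : v ≠ 0) : 0 < lorentz v v := by
  obtain ⟨hpp, hp0⟩ := hp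
  have hcs := Finset.sum_mul_sq_le_sq_mul_sq Finset.univ (fun i : Fin n => p i.succ)
    (fun i : Fin n => v i.succ)
  simp only [lorentz, ← pow_two] at hpp hpv ⊢
  have hV : 0 ≤ ∑ i : Fin n, v i.succ ^ 2 := Finset.sum_nonneg fun i _ => sq_nonneg _
  set V := ∑ i : Fin n, v i.succ ^ 2 with hVdef
  have hS : ∑ i : Fin n, p i.succ * v i.succ = p 0 * v 0 := by linarith
  rw [hS] at hcs
  have hP : ∑ i : Fin n, p i.succ ^ 2 = p 0 ^ 2 - 1 := by linarith
  rw [hP] at hcs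
  -- Cauchy–Schwarz on the spatial parts reads `p₀² v₀² ≤ (p₀² - 1) V`.
  have key : V ≤ p 0 ^ 2 * (V - v 0 ^ 2) := by nlinarith
  have hp2 : 0 < p 0 ^ 2 := by positivity
  rcases hV.eq_or_lt with h0 | h0
  · have hs : ∀ i : Fin n, v i.succ = 0 := fun i => by
      have := (Finset.sum_eq_zero_iff_of_nonneg (fun i _ => sq_nonneg (v (Fin.succ i)))).1 h0.symm
      exact pow_eq_zero_iff two_ne_zero |>.1 (this i (Finset.mem_univ i))
    have h00 : v 0 = 0 := by
      simp only [hs, mul_zero, Finset.sum_const_zero] at hS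
      rcases mul_eq_zero.1 hS.symm with h | h
      · exact absurd h hp0.ne'
      · exact h
    exact absurd (by ext i; exact Fin.cases h00 hs i) hv
  · have : 0 < V - v 0 ^ 2 := pos_of_mul_pos_right (h0.trans_le key) hp2.le
    linarith

/-- Reverse Cauchy–Schwarz: the spatial product `S` satisfies `S² ≤ (p₀² - 1)(q₀² - 1) = (p₀ q₀ -
1)² - (p₀ - q₀)²`. -/
theorem one_le_neg_lorentz {n : ℕ} {p q : EuclideanSpace ℝ (Fin (n + 1))}
    (hp : p ∈ hyperbolicSpace n) (hq : q ∈ hyperbolicSpace n) : 1 ≤ -lorentz p q := by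
  obtain ⟨hpp, hp0⟩ := hp
  obtain ⟨hqq, hq0⟩ := hq
  have hcs := Finset.sum_mul_sq_le_sq_mul_sq Finset.univ (fun i : Fin n => p i.succ)
    (fun i : Fin n => q i.succ)
  simp only [lorentz, ← pow_two] at hpp hqq ⊢
  set S := ∑ i : Fin n, p i.succ * q i.succ
  rw [show ∑ i : Fin n, p i.succ ^ 2 = p 0 ^ 2 - 1 by linarith,
    show ∑ i : Fin n, q i.succ ^ 2 = q 0 ^ 2 - 1 by linarith] at hcs
  have hP : 0 ≤ ∑ i : Fin n, p i.succ ^ 2 := Finset.sum_nonneg fun i _ => sq_nonneg _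
  have hQ : 0 ≤ ∑ i : Fin n, q i.succ ^ 2 := Finset.sum_nonneg fun i _ => sq_nonneg _
  have hp1 : 1 ≤ p 0 := by nlinarith
  have hq1 : 1 ≤ q 0 := by nlinarith
  have h1 : S ^ 2 ≤ (p 0 * q 0 - 1) ^ 2 := by nlinarith [sq_nonneg (p 0 - q 0)]
  have h2 : 0 ≤ p 0 * q 0 - 1 := by nlinarith
  have := abs_le_of_sq_le_sq h1 h2
  linarith [(abs_le.1 this).2]

/-- Writing `A` as a sum of rank-one matrices `v vᵀ` turns the trace into a sum of values of the
quadratic form of `B`, so `B` need not be symmetric. -/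
theorem trace_mul_nonneg_of_posSemidef {ι : Type*} [Fintype ι] {A B : Matrix ι ι ℝ}
    (hA : A.PosSemidef) (hB : ∀ v : ι → ℝ, 0 ≤ v ⬝ᵥ B.mulVec v) : 0 ≤ (A * B).trace := by
  obtain ⟨k, v, rfl⟩ := Matrix.posSemidef_iff_eq_sum_vecMulVec.1 hA
  rw [Finset.sum_mul, Matrix.trace_sum]
  refine Finset.sum_nonneg fun i _ => ?_
  rw [Matrix.vecMulVec_mul, Matrix.trace_vecMulVec, star_trivial, dotProduct_comm,
    ← Matrix.dotProduct_mulVec]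
  exact hB _

/-! ### Second-order conditions at a local maximum -/

/-- A positive second derivative would make `a` a local minimum as well, hence `f` locally constant,
which forces the second derivative to vanish. -/
theorem deriv_deriv_nonpos_of_isLocalMax {f : ℝ → ℝ} {a : ℝ} (h : IsLocalMax f a)
    (hc : ContinuousAt f a) : deriv (deriv f) a ≤ 0 := by
  by_contra! hpos
  have hmin := isLocalMin_of_deriv_deriv_pos hpos h.deriv_eq_zero hc
  have hconst : f =ᶠ[nhds a] fun _ => f a := by
    filter_upwards [h, hmin] with x h1 h2 using le_antisymm h1 h2
  have := hconst.deriv.deriv_eq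
  simp at this
  linarith

section SecondOrder

variable {E V : Type*} [NormedAddCommGroup E] [NormedSpace ℝ E] [NormedAddCommGroup V]
  [NormedSpace ℝ V]

theorem eventually_hasDerivAt_comp_line {G : E → V} {y : E} (hG : ContDiffAt ℝ 2 G y) (c : E) :
    ∀ᶠ s in nhds (0 : ℝ),
      HasDerivAt (fun s : ℝ => G (y + s • c)) (fderiv ℝ G (y + s • c) c) s := by
  have hl : ∀ s : ℝ, HasDerivAt (fun s : ℝ => y + s • c) c s := fun s => by
    simpa using ((hasDerivAt_id s).smul_const c).const_add y
  have ht : Filter.Tendsto (fun s : ℝ => y + s • c) (nhds 0) (nhds y) := by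
    simpa using (hl 0).continuousAt.tendsto
  filter_upwards [ht.eventually (hG.eventually (by simp))] with s hs
  exact (hs.differentiableAt (by simp)).hasFDerivAt.comp_hasDerivAt s (hl s)

theorem hasDerivAt_fderiv_comp_line {G : E → V} {y : E} (hG : ContDiffAt ℝ 2 G y) (c : E) :
    HasDerivAt (fun s : ℝ => fderiv ℝ G (y + s • c) c) (fderiv ℝ (fderiv ℝ G) y c c) 0 := by
  have hl : HasDerivAt (fun s : ℝ => y + s • c) c 0 := by
    simpa using ((hasDerivAt_id (0 : ℝ)).smul_const c).const_add y
  have hd : HasFDerivAt (fderiv ℝ G) (fderiv ℝ (fderiv ℝ G) y) (y + (0 : ℝ) • c) := by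
    rw [zero_smul, add_zero]
    exact ((hG.fderiv_right (m := 1) (by norm_num)).differentiableAt (by simp)).hasFDerivAt
  have hcomp : HasDerivAt (fun s : ℝ => fderiv ℝ G (y + s • c)) (fderiv ℝ (fderiv ℝ G) y c) 0 :=
    hd.comp_hasDerivAt (0 : ℝ) hl
  simpa using hcomp.clm_apply (hasDerivAt_const (0 : ℝ) c)

theorem fderiv_eq_zero_and_fderiv_fderiv_nonpos_of_isLocalMax {G : E → V} {y : E}
    (hG : ContDiffAt ℝ 2 G y) (L : V →L[ℝ] ℝ) (h : IsLocalMax (fun z => L (G z)) y) (c : E) :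
    L (fderiv ℝ G y c) = 0 ∧ L (fderiv ℝ (fderiv ℝ G) y c c) ≤ 0 := by
  have hl : Filter.Tendsto (fun s : ℝ => y + s • c) (nhds 0) (nhds y) := by
    have : ContinuousAt (fun s : ℝ => y + s • c) 0 := by fun_prop
    simpa using this.tendsto
  have hmax : IsLocalMax (fun s : ℝ => L (G (y + s • c))) 0 := by
    have := hl.eventually h
    simpa [IsLocalMax, IsMaxFilter] using this
  have h1 : ∀ᶠ s in nhds (0 : ℝ), HasDerivAt (fun s : ℝ => L (G (y + s • c)))
      (L (fderiv ℝ G (y + s • c) c)) s := by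
    filter_upwards [eventually_hasDerivAt_comp_line hG c] with s hs
    exact L.hasFDerivAt.comp_hasDerivAt s hs
  have h2 : HasDerivAt (fun s : ℝ => L (fderiv ℝ G (y + s • c) c))
      (L (fderiv ℝ (fderiv ℝ G) y c c)) 0 :=
    L.hasFDerivAt.comp_hasDerivAt (0 : ℝ) (hasDerivAt_fderiv_comp_line hG c)
  constructor
  · simpa using hmax.hasDerivAt_eq_zero h1.self_of_nhds
  · have hle := deriv_deriv_nonpos_of_isLocalMax hmax h1.self_of_nhds.continuousAt
    have he : deriv (fun s : ℝ => L (G (y + s • c))) =ᶠ[nhds 0]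
        fun s => L (fderiv ℝ G (y + s • c) c) := h1.mono fun s hs => hs.deriv
    rwa [he.deriv_eq, h2.deriv] at hle

end SecondOrder

/-! ### The Hessian inequality for a parametrized hypersurface -/

variable {m : ℕ}

/-- Both identities come from differentiating `⟨G, G⟩ = -1` along the line `s ↦ y + s c`, once and
twice. -/
theorem lorentz_fderiv_eq_zero_of_mem {G : EuclideanSpace ℝ (Fin m) →
    EuclideanSpace ℝ (Fin (m + 2))} {y : EuclideanSpace ℝ (Fin m)} (hG : ContDiffAt ℝ 2 G y)
    (hyp : ∀ z, G z ∈ hyperbolicSpace (m + 1)) (c : EuclideanSpace ℝ (Fin m)) :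
    lorentz (G y) (fderiv ℝ G y c) = 0 ∧
      lorentz (G y) (fderiv ℝ (fderiv ℝ G) y c c) =
        -lorentz (fderiv ℝ G y c) (fderiv ℝ G y c) := by
  have h1 := eventually_hasDerivAt_comp_line hG c
  have h0 : ∀ᶠ s in nhds (0 : ℝ),
      lorentz (G (y + s • c)) (fderiv ℝ G (y + s • c) c) = 0 := by
    filter_upwards [h1] with s hs
    have hB := (lorentzCLM (m + 1)).hasFDerivAt_of_bilinear hs.hasFDerivAt hs.hasFDerivAt
    have hc : (fun s : ℝ => lorentzCLM (m + 1) (G (y + s • c)) (G (y + s • c))) = fun _ => -1 :=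
      funext fun s => (hyp _).1
    rw [hc] at hB
    have := congrArg (fun T : ℝ →L[ℝ] ℝ => T 1) (hB.unique (hasFDerivAt_const (-1 : ℝ) s))
    simp [lorentz_comm (fderiv ℝ G (y + s • c) c)] at this
    linarith
  have h2 := hasDerivAt_fderiv_comp_line hG c
  refine ⟨by simpa using h0.self_of_nhds, ?_⟩
  have hB := (lorentzCLM (m + 1)).hasFDerivAt_of_bilinear h1.self_of_nhds.hasFDerivAt
    h2.hasFDerivAt
  have hz : HasFDerivAt (fun s : ℝ => lorentzCLM (m + 1) (G (y + s • c))
      (fderiv ℝ G (y + s • c) c)) (0 : ℝ →L[ℝ] ℝ) 0 :=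
    (hasFDerivAt_const (0 : ℝ) (0 : ℝ)).congr_of_eventuallyEq h0
  have := congrArg (fun T : ℝ →L[ℝ] ℝ => T 1) (hB.unique hz)
  simp at this
  linarith

/-- A vector orthogonal to the image of the differential of a hypersurface of hyperbolic space is
a combination of the position vector and the unit normal. -/
theorem eq_position_add_normal {q ν p : EuclideanSpace ℝ (Fin (m + 2))}
    {D : EuclideanSpace ℝ (Fin m) →L[ℝ] EuclideanSpace ℝ (Fin (m + 2))}
    (hq : lorentz q q = -1) (hD : Function.Injective D) (hqD : ∀ c, lorentz q (D c) = 0)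
    (hqν : lorentz q ν = 0) (hDν : ∀ c, lorentz (D c) ν = 0) (hν : lorentz ν ν = 1)
    (hp : ∀ c, lorentz p (D c) = 0) :
    p = (-lorentz p q) • q + lorentz p ν • ν := by
  let T : (ℝ × EuclideanSpace ℝ (Fin m) × ℝ) →ₗ[ℝ] EuclideanSpace ℝ (Fin (m + 2)) :=
    (LinearMap.toSpanSingleton ℝ _ q).coprod
      ((D : EuclideanSpace ℝ (Fin m) →ₗ[ℝ] EuclideanSpace ℝ (Fin (m + 2))).coprod
        (LinearMap.toSpanSingleton ℝ _ ν))
  have hT : ∀ a c b, T (a, c, b) = a • q + (D c + b • ν) := fun a c b => rfl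
  have expand : ∀ w a c b, lorentz w (T (a, c, b)) =
      a * lorentz w q + (lorentz w (D c) + b * lorentz w ν) := fun w a c b => by
    rw [hT, ← lorentzCLM_apply, map_add, map_add, map_smul, map_smul]; rfl
  have hinj : Function.Injective T := by
    rw [injective_iff_map_eq_zero]
    rintro ⟨a, c, b⟩ h
    have e1 := expand q a c b
    have e2 := expand ν a c b
    rw [h, ← lorentzCLM_apply, map_zero] at e1 e2
    rw [hq, hqD, hqν] at e1
    rw [lorentz_comm ν q, hqν, lorentz_comm ν (D c), hDν, hν] at e2
    have ha : a = 0 := by linarith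
    have hb : b = 0 := by linarith
    rw [hT, ha, hb, zero_smul, zero_smul, zero_add, add_zero] at h
    have hc : c = 0 := hD (by rw [h, map_zero])
    simp [ha, hb, hc]
  -- Dimension count: `1 + m + 1 = m + 2`, so `q`, the image of `D` and `ν` together span the
  -- ambient space.
  have hsurj : Function.Surjective T :=
    (LinearMap.injective_iff_surjective_of_finrank_eq_finrank (by simp; ring)).1 hinj
  rw [← sub_eq_zero]
  refine eq_zero_of_forall_lorentz_eq_zero fun y => ?_
  obtain ⟨⟨a, c, b⟩, rfl⟩ := hsurj y
  have hw : ∀ z, lorentz (p - ((-lorentz p q) • q + lorentz p ν • ν)) z =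
      lorentz p z + lorentz p q * lorentz q z - lorentz p ν * lorentz ν z := fun z => by
    rw [← lorentzCLM_apply]; simp; ring
  rw [expand, hw, hw, hw, hq, hp, hqD, hqν, hν, lorentz_comm ν q, hqν, lorentz_comm ν (D c), hDν]
  ring

/-- The trace of the second-derivative test: the Hessian of `-⟨p, G⟩` at the maximum is `-⟨p, G⟩ g +
⟨p, ν⟩ h`, and `g⁻¹` is positive definite. -/
theorem neg_lorentz_add_trace_le_zero (hm : 1 ≤ m) {G : EuclideanSpace ℝ (Fin m) →
    EuclideanSpace ℝ (Fin (m + 2))} {y : EuclideanSpace ℝ (Fin m)} (hG : ContDiffAt ℝ 2 G y)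
    (hyp : ∀ z, G z ∈ hyperbolicSpace (m + 1)) (hinj : Function.Injective (fderiv ℝ G y))
    {ν p : EuclideanSpace ℝ (Fin (m + 2))}
    (hGν : lorentz (G y) ν = 0) (hDν : ∀ c, lorentz (fderiv ℝ G y c) ν = 0)
    (hν : lorentz ν ν = 1) (hmax : IsLocalMax (fun z => -lorentz p (G z)) y)
    {g h : Matrix (Fin m) (Fin m) ℝ}
    (hg : ∀ i j, g i j = lorentz (partialDeriv i G y) (partialDeriv j G y))
    (hh : ∀ i j, h i j = -lorentz (partialDeriv i (partialDeriv j G) y) ν) :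
    -lorentz p (G y) + lorentz p ν * ((g⁻¹ * h).trace / m) ≤ 0 := by
  have hcrit := fderiv_eq_zero_and_fderiv_fderiv_nonpos_of_isLocalMax hG (-lorentzCLM (m + 1) p)
    (by simpa using hmax)
  have hyp' := lorentz_fderiv_eq_zero_of_mem hG hyp
  have hp : p = (-lorentz p (G y)) • G y + lorentz p ν • ν :=
    eq_position_add_normal (hyp y).1 hinj (fun c => (hyp' c).1) hGν hDν hν
      fun c => by simpa using (hcrit c).1
  have hvec : ∀ v : Fin m → ℝ,
      WithLp.toLp 2 v = ∑ i, v i • EuclideanSpace.single i (1 : ℝ) := fun v => by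
    simpa using ((EuclideanSpace.basisFun (Fin m) ℝ).sum_repr (WithLp.toLp 2 v)).symm
  have hquad : ∀ (B : EuclideanSpace ℝ (Fin m) →L[ℝ] EuclideanSpace ℝ (Fin m) →L[ℝ] ℝ)
      (A : Matrix (Fin m) (Fin m) ℝ)
      (_ : ∀ i j, A i j = B (EuclideanSpace.single i 1) (EuclideanSpace.single j 1))
      (v : Fin m → ℝ), v ⬝ᵥ A.mulVec v = B (WithLp.toLp 2 v) (WithLp.toLp 2 v) := by
    intro B A hA v
    rw [hvec]
    simp only [map_sum, map_smul, _root_.sum_apply, _root_.smul_apply,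
      dotProduct, Matrix.mulVec, hA, Finset.mul_sum, smul_eq_mul]
    rw [Finset.sum_comm]
    refine Finset.sum_congr rfl fun i _ => Finset.sum_congr rfl fun j _ => by ring
  have hgq : ∀ v : Fin m → ℝ, v ⬝ᵥ g.mulVec v =
      lorentz (fderiv ℝ G y (WithLp.toLp 2 v)) (fderiv ℝ G y (WithLp.toLp 2 v)) :=
    hquad ((lorentzCLM (m + 1)).bilinearComp (fderiv ℝ G y) (fderiv ℝ G y)) g
      fun i j => by simp [hg, partialDeriv]
  have hdiff : DifferentiableAt ℝ (fderiv ℝ G) y :=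
    (hG.fderiv_right (m := 1) (by norm_num)).differentiableAt (by simp)
  have hpart : ∀ i j, partialDeriv i (partialDeriv j G) y =
      fderiv ℝ (fderiv ℝ G) y (EuclideanSpace.single i 1) (EuclideanSpace.single j 1) := by
    intro i j
    have : HasFDerivAt (partialDeriv j G) _ y :=
      hdiff.hasFDerivAt.clm_apply (hasFDerivAt_const (EuclideanSpace.single j (1 : ℝ)) y)
    rw [partialDeriv, this.fderiv]
    simp
  have hhq : ∀ v : Fin m → ℝ, v ⬝ᵥ h.mulVec v =
      -lorentz (fderiv ℝ (fderiv ℝ G) y (WithLp.toLp 2 v) (WithLp.toLp 2 v)) ν := fun v => by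
    rw [hquad ((ContinuousLinearMap.compL ℝ _ _ ℝ (-(lorentzCLM (m + 1)).flip ν)).comp
      (fderiv ℝ (fderiv ℝ G) y)) h (fun i j => by simp [hh, hpart]) v]
    simp
  have hgpos : g.PosDef := by
    refine Matrix.PosDef.of_dotProduct_mulVec_pos ?_ fun v hv => ?_
    · ext i j
      simp [hg, lorentz_comm]
    · rw [star_trivial, hgq]
      refine lorentz_self_pos (hyp y) (hyp' _).1 fun h0 => hv ?_
      have := hinj (h0.trans (map_zero _).symm)
      simpa using this
  have hdet : IsUnit g.det := (Matrix.isUnit_iff_isUnit_det g).1 hgpos.isUnit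
  have htr := trace_mul_nonneg_of_posSemidef hgpos.posSemidef.inv
    -- This is minus the Hessian; its sign follows by pairing the decomposition `hp` of `p` with the
    -- second derivative of `G`.
    (B := -((-lorentz p (G y)) • g + lorentz p ν • h)) fun v => by
      have h1 := (hcrit (WithLp.toLp 2 v)).2
      have h2 := (hyp' (WithLp.toLp 2 v)).2
      have h3 := congrArg (fun w => lorentzCLM (m + 1) w
        (fderiv ℝ (fderiv ℝ G) y (WithLp.toLp 2 v) (WithLp.toLp 2 v))) hp
      simp only [map_add, map_smul, _root_.add_apply, _root_.smul_apply,
        lorentzCLM_apply, smul_eq_mul, _root_.neg_apply] at h1 h3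
      rw [h2, lorentz_comm ν] at h3
      simp only [Matrix.neg_mulVec, Matrix.add_mulVec, Matrix.smul_mulVec, dotProduct_neg,
        dotProduct_add, dotProduct_smul, hgq, hhq, smul_eq_mul]
      linarith
  rw [mul_neg, mul_add, mul_smul_comm, mul_smul_comm, Matrix.nonsing_inv_mul _ hdet,
    Matrix.trace_neg, Matrix.trace_add, Matrix.trace_smul, Matrix.trace_smul, Matrix.trace_one,
    Fintype.card_fin, smul_eq_mul, smul_eq_mul] at htr
  have hm0 : (0 : ℝ) < m := by exact_mod_cast hm
  have : -lorentz p (G y) + lorentz p ν * ((g⁻¹ * h).trace / m) =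
      (-lorentz p (G y) * m + lorentz p ν * (g⁻¹ * h).trace) / m := by
    field_simp
  rw [this]
  exact div_nonpos_of_nonpos_of_nonneg (by linarith) hm0.le

/-! ### Transfer from the chart to the manifold -/

variable {N : Type*} [TopologicalSpace N] [ChartedSpace (EuclideanSpace ℝ (Fin m)) N]

theorem contDiffAt_localMap [IsManifold (𝓡 m) ∞ N] {F : N → hyperbolicSpace (m + 1)}
    (hF : IsSmoothImmersion F) (x : N) :
    ContDiffAt ℝ ∞ (localMap F x) (extChartAt (𝓡 m) x x) := by
  have h : ContDiffWithinAt ℝ ∞ (localMap F x) (Set.range (𝓡 m)) (extChartAt (𝓡 m) x x) :=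
    (contMDiffAt_iff.1 (hF.smooth x)).2
  rwa [ModelWithCorners.range_eq_univ, contDiffWithinAt_univ] at h

theorem mfderiv_ambient {F : N → hyperbolicSpace (m + 1)} (hF : IsSmoothImmersion F) (x : N) :
    mfderiv (𝓡 m) 𝓘(ℝ, EuclideanSpace ℝ (Fin (m + 2))) (ambient F) x =
      fderiv ℝ (localMap F x) (extChartAt (𝓡 m) x x) := by
  rw [((hF.smooth x).mdifferentiableAt (by simp)).mfderiv]
  change fderivWithin ℝ (localMap F x) (Set.range (𝓡 m)) (extChartAt (𝓡 m) x x) = _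
  rw [ModelWithCorners.range_eq_univ, fderivWithin_univ]

theorem neg_lorentz_add_meanCurvature_le_zero [IsManifold (𝓡 m) ∞ N] (hm : 1 ≤ m)
    {F : N → hyperbolicSpace (m + 1)} (hF : IsSmoothImmersion F) {x : N}
    {ν p : EuclideanSpace ℝ (Fin (m + 2))} (hν : IsUnitNormal F x ν)
    (hmax : IsLocalMax (fun z => -lorentz p (ambient F z)) x) :
    -lorentz p (ambient F x) + lorentz p ν * meanCurvature F x ν ≤ 0 := by
  have hx : localMap F x (extChartAt (𝓡 m) x x) = ambient F x := by
    simp [localMap]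
  have hmf := mfderiv_ambient hF x
  have hmax' : IsLocalMax (fun z => -lorentz p (localMap F x z)) (extChartAt (𝓡 m) x x) := by
    have hc : Filter.Tendsto (extChartAt (𝓡 m) x).symm (nhds (extChartAt (𝓡 m) x x)) (nhds x) := by
      simpa using (continuousAt_extChartAt_symm (I := 𝓡 m) x).tendsto
    have := hc.eventually hmax
    simpa [IsLocalMax, IsMaxFilter, localMap] using this
  have key := neg_lorentz_add_trace_le_zero hm (G := localMap F x)
    (y := extChartAt (𝓡 m) x x) ((contDiffAt_localMap hF x).of_le (by norm_cast))
    (fun z => (F _).2) (hmf ▸ hF.injective_mfderiv x) (ν := ν) (p := p)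
    (hx ▸ hν.tangent) (fun c => by rw [← hmf]; exact hν.normal c) hν.unit hmax'
    (g := firstFundamentalForm F x) (h := secondFundamentalForm F x ν)
    (fun i j => rfl) (fun i j => rfl)
  rwa [hx] at key

/-! ### The maximum principle in time -/

theorem Icc_subset_timeInterval {T : ℝ≥0∞} {t : ℝ} (ht : t ∈ timeInterval T) :
    Set.Icc 0 t ⊆ timeInterval T := fun _ hs =>
  ⟨hs.1, (ENNReal.ofReal_le_ofReal hs.2).trans_lt ht.2⟩

/-- Only the backward direction, from `a` towards `0`, is tested, so the endpoint `a = b` is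
allowed. -/
theorem deriv_nonneg_of_isMaxOn_Icc {f : ℝ → ℝ} {f' a b : ℝ} (ha : a ∈ Set.Ioc 0 b)
    (hf : HasDerivWithinAt f f' (Set.Icc 0 b) a) (hmax : IsMaxOn f (Set.Icc 0 b) a) : 0 ≤ f' := by
  have hseg : segment ℝ a 0 ⊆ Set.Icc 0 b :=
    (convex_Icc 0 b).segment_subset ⟨ha.1.le, ha.2⟩ ⟨le_rfl, ha.1.le.trans ha.2⟩
  have h := hmax.localize.hasFDerivWithinAt_nonpos hf.hasFDerivWithinAt
    (sub_mem_posTangentConeAt_of_segment_subset hseg)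
  simp at h
  nlinarith [ha.1]

theorem IsMeanCurvatureFlow.exp_mul_neg_lorentz_le [IsManifold (𝓡 m) ∞ N] [CompactSpace N]
    (hm : 1 ≤ m) {F₀ : N → hyperbolicSpace (m + 1)} {T : ℝ≥0∞}
    {F : ℝ → N → hyperbolicSpace (m + 1)} (hF : IsMeanCurvatureFlow F₀ T F)
    {p : EuclideanSpace ℝ (Fin (m + 2))} {M : ℝ} (hM : ∀ x, -lorentz p (ambient F₀ x) ≤ M)
    {t : ℝ} (ht : t ∈ timeInterval T) (x : N) :
    Real.exp t * -lorentz p (ambient (F t) x) ≤ M := by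
  refine le_of_forall_pos_le_add fun δ hδ => ?_
  have ht0 : 0 ≤ t := ht.1
  -- Chosen so that `ε t ≤ δ`, with a denominator that stays positive at `t = 0`.
  set ε := δ / (t + 1) with hεdef
  have hε : 0 < ε := by positivity
  have hsub := Icc_subset_timeInterval ht
  set w : N × ℝ → ℝ := fun z =>
    Real.exp z.2 * -lorentz p (ambient (F z.2) z.1) - ε * z.2 with hw
  have hcont : ContinuousOn w (Set.univ ×ˢ Set.Icc 0 t) := by
    have h1 : ContinuousOn (fun z : N × ℝ => ambient (F z.2) z.1) (Set.univ ×ˢ Set.Icc 0 t) :=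
      hF.smooth.continuousOn.mono (Set.prod_mono_right hsub)
    have h2 : ContinuousOn (fun z : N × ℝ => lorentz p (ambient (F z.2) z.1))
        (Set.univ ×ˢ Set.Icc 0 t) := (lorentzCLM (m + 1) p).continuous.comp_continuousOn h1
    exact ((Real.continuous_exp.comp continuous_snd).continuousOn.mul h2.neg).sub
      (continuous_const.mul continuous_snd).continuousOn
  obtain ⟨⟨x₁, t₁⟩, ⟨-, ht₁⟩, hmax⟩ := (isCompact_univ.prod isCompact_Icc).exists_isMaxOn
    ⟨(x, t), Set.mem_univ _, ht0, le_rfl⟩ hcont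
  have hwx : w (x, t) ≤ w (x₁, t₁) := hmax ⟨Set.mem_univ _, ht0, le_rfl⟩
  -- At a maximum with `t₁ > 0` the time derivative of `w` is at least `0`, yet it equals `exp t₁ *
  -- (u + ⟨p, ν⟩ H) - ε ≤ -ε`. The term `ε t` supplies this strictness.
  have ht₁0 : t₁ = 0 := by
    by_contra hne
    have hpos : 0 < t₁ := lt_of_le_of_ne ht₁.1 (Ne.symm hne)
    obtain ⟨ν, hν, hd⟩ := hF.evolution t₁ (hsub ht₁) x₁
    have hmaxx : IsLocalMax (fun z => -lorentz p (ambient (F t₁) z)) x₁ :=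
      Filter.Eventually.of_forall fun z => by
        have := hmax (show (z, t₁) ∈ Set.univ ×ˢ Set.Icc 0 t from ⟨Set.mem_univ _, ht₁⟩)
        simp only [hw, Set.mem_ofPred_eq] at this
        exact le_of_mul_le_mul_left (by linarith) (Real.exp_pos t₁)
    have hsp := neg_lorentz_add_meanCurvature_le_zero hm (hF.immersion t₁ (hsub ht₁)) hν hmaxx
    have hd1 : HasDerivWithinAt (fun s => lorentz p (ambient (F s) x₁))
        (lorentz p (-(meanCurvature (F t₁) x₁ ν • ν))) (Set.Icc 0 t) t₁ :=
      (lorentzCLM (m + 1) p).hasFDerivAt.comp_hasDerivWithinAt t₁ (hd.mono hsub)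
    have hd2 := ((Real.hasDerivAt_exp t₁).hasDerivWithinAt.mul hd1.neg).sub
      ((hasDerivWithinAt_id t₁ (Set.Icc 0 t)).const_mul ε)
    have hnonneg := deriv_nonneg_of_isMaxOn_Icc ⟨hpos, ht₁.2⟩ hd2
      fun s hs => hmax (show (x₁, s) ∈ Set.univ ×ˢ Set.Icc 0 t from ⟨Set.mem_univ _, hs⟩)
    have hlin : lorentz p (-(meanCurvature (F t₁) x₁ ν • ν)) =
        -(meanCurvature (F t₁) x₁ ν * lorentz p ν) := by
      rw [← lorentzCLM_apply, map_neg, map_smul]; rfl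
    simp only [hlin, Pi.neg_apply, neg_neg] at hnonneg
    linarith [mul_nonpos_of_nonneg_of_nonpos (Real.exp_pos t₁).le hsp]
  subst ht₁0
  have h0 : w (x₁, 0) ≤ M := by simpa [hw, hF.initial] using hM x₁
  have hεt : ε * t ≤ δ := by
    rw [hεdef, div_mul_eq_mul_div, div_le_iff₀ (by positivity)]
    nlinarith
  have := hwx.trans h0
  simp only [hw] at this
  linarith

/-! ### The diameter bound and the conclusion -/

theorem neg_lorentz_le_cosh_hypDiam {n : ℕ} {S : Set (hyperbolicSpace n)} (hS : IsCompact S)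
    {p q : hyperbolicSpace n} (hp : p ∈ S) (hq : q ∈ S) :
    -lorentz (p : EuclideanSpace ℝ (Fin (n + 1))) q ≤ Real.cosh (hypDiam S) := by
  have h1 := one_le_neg_lorentz p.2 q.2
  have hc : Continuous fun z : hyperbolicSpace n × hyperbolicSpace n => hypDist z.1 z.2 := by
    refine Real.continuousOn_arcosh.comp_continuous ?_ fun z => one_le_neg_lorentz z.1.2 z.2.2
    exact ((lorentzCLM n).continuous₂.comp
      ((continuous_subtype_val.comp continuous_fst).prodMk
        (continuous_subtype_val.comp continuous_snd))).neg
  -- Compactness is needed here: the real `sSup` of an unbounded set is `0` by default.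
  have hb : BddAbove {r | ∃ p ∈ S, ∃ q ∈ S, r = hypDist p q} := by
    refine ((hS.prod hS).image hc).bddAbove.mono ?_
    rintro r ⟨a, ha, b, hb, rfl⟩
    exact ⟨(a, b), ⟨ha, hb⟩, rfl⟩
  have hle : hypDist p q ≤ hypDiam S := le_csSup hb ⟨p, hp, q, hq, rfl⟩
  have h0 : 0 ≤ hypDist p q := Real.arcosh_nonneg h1
  calc -lorentz (p : EuclideanSpace ℝ (Fin (n + 1))) q = Real.cosh (hypDist p q) :=
        (Real.cosh_arcosh h1).symm
    _ ≤ Real.cosh (hypDiam S) := by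
        rwa [Real.cosh_le_cosh, abs_of_nonneg h0, abs_of_nonneg (h0.trans hle)]

end HyperbolicMCF

theorem corollary3p5 (m : ℕ) (hm : 1 ≤ m) (N : Type*) [TopologicalSpace N] [T2Space N]
    [CompactSpace N] [Nonempty N] [ChartedSpace (EuclideanSpace ℝ (Fin m)) N]
    [IsManifold (𝓡 m) ∞ N] (F₀ : N → HyperbolicMCF.hyperbolicSpace (m + 1))
    (hF₀ : HyperbolicMCF.IsSmoothEmbedding F₀) :
    HyperbolicMCF.maximalTime F₀ ≤
      ENNReal.ofReal (Real.log (Real.cosh (HyperbolicMCF.hypDiam (Set.range F₀)))) := by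
  refine sSup_le ?_
  rintro T ⟨F, hF⟩
  -- The flow is defined only at times strictly below `T`, which may be infinite, so the bound is
  -- proved at a finite time `d` between `c` and `T`.
  refine le_of_forall_lt fun c hc => ?_
  obtain ⟨d, hcd, hdT⟩ := exists_between hc
  refine hcd.trans_le ?_
  have hd : ENNReal.ofReal d.toReal = d := ENNReal.ofReal_toReal hdT.ne_top
  rw [← hd]
  refine ENNReal.ofReal_le_ofReal ?_
  have ht : d.toReal ∈ HyperbolicMCF.timeInterval T := ⟨ENNReal.toReal_nonneg, by rwa [hd]⟩
  obtain ⟨x⟩ := ‹Nonempty N›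
  -- The base point is the initial position of `x` itself; any point of the initial hypersurface
  -- would serve.
  have hbound := hF.exp_mul_neg_lorentz_le hm (p := HyperbolicMCF.ambient F₀ x)
    (fun y => HyperbolicMCF.neg_lorentz_le_cosh_hypDiam
      (isCompact_range hF₀.isEmbedding.continuous) (Set.mem_range_self x) (Set.mem_range_self y))
    ht x
  have h1 := HyperbolicMCF.one_le_neg_lorentz (F₀ x).2 (F d.toReal x).2
  rw [Real.le_log_iff_exp_le (Real.cosh_pos _)]
  exact (le_mul_of_one_le_right (Real.exp_pos _).le h1).trans hbound
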